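/- Let $\mathbb K\in\{\mathbb R,\mathbb C\}$ and let $G$ be a (real or complex) Lie group of dimension $m\ge 1$ over $\mathbb K$, with Lie algebra $\mathfrak g$. Let $\mathfrak g^*$ be the space of all $\mathbb K$-linear functionals on $\mathfrak g$, on which $G$ acts by the coadjoint action. For $\xi\in\mathfrak g^*$ let $$\mathfrak g(\xi):=\{x\in\mathfrak g\mid \xi([x,y])=0\ \text{for all } y\in\mathfrak g\}$$ be its coadjoint stabilizer subalgebra. Let $\operatorname{Gr}(\mathfrak g)$ be the Grassmann manifold of all linear subspaces of $\mathfrak g$ (the disjoint union of the Grassmannians of $k$-dimensional subspaces, $0\le k\le m$). For every integer $d\ge 0$ let $\Xi_d\subseteq\mathfrak g^*$ be the set of all functionals whose coadjoint orbit is $d$-dimensional over $\mathbb K$. Then, for any subset $\Xi\subseteq\mathfrak g^*$, the mapping $$\Xi\to\operatorname{Gr}(\mathfrak g),\qquad \xi\mapsto\mathfrak g(\xi),$$ is continuous if and only if for every even integer $d\in\{0,\dots,m\}$ the set $\Xi\cap\Xi_d$ is relatively closed in $\Xi$. -/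

import Mathlib

open scoped Manifold

noncomputable section

/-- The Grassmann manifold `Gr(V)` of a finite-dimensional vector space `V`:
the set of all linear subspaces of `V`, of all dimensions. -/
def Gr (𝕜 V : Type*) [Field 𝕜] [AddCommGroup V] [Module 𝕜 V] : Type _ :=
  Submodule 𝕜 V

namespace Gr

/-- The space of `k`-frames of `V` (the noncompact Stiefel manifold): the linearly independent
`k`-tuples of vectors of `V`. -/
abbrev Frame (𝕜 V : Type*) [Field 𝕜] [AddCommGroup V] [Module 𝕜 V] (k : ℕ) : Type _ :=
  {f : Fin k → V // LinearIndependent 𝕜 f}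

/-- The linear subspace spanned by a frame. -/
def ofFrame (𝕜 V : Type*) [Field 𝕜] [AddCommGroup V] [Module 𝕜 V] (k : ℕ)
    (f : Frame 𝕜 V k) : Gr 𝕜 V :=
  Submodule.span 𝕜 (Set.range f.1)

/-- The topology of the Grassmann manifold: it is the disjoint union of the spaces `Gr_k(V)` of
`k`-dimensional subspaces, where `Gr_k(V)` is the quotient of the space of `k`-frames by the map
that sends a frame to its span. That is, a set of subspaces is open if and only if for each `k`
its preimage in the space of `k`-frames (with the topology of `V ^ k`) is open. -/
instance (𝕜 V : Type*) [Field 𝕜] [AddCommGroup V] [Module 𝕜 V] [TopologicalSpace V] :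
    TopologicalSpace (Gr 𝕜 V) :=
  ⨆ k : ℕ, TopologicalSpace.coinduced (ofFrame 𝕜 V k) inferInstance

end Gr

namespace Coadjoint

variable {𝕜 : Type*} [RCLike 𝕜] {E : Type*} [NormedAddCommGroup E] [NormedSpace 𝕜 E]
  {H : Type*} [TopologicalSpace H] (I : ModelWithCorners 𝕜 E H)
  (G : Type*) [TopologicalSpace G] [ChartedSpace H G] [Group G]

/-- The linear dual `𝔤*` of the Lie algebra `𝔤 = GroupLieAlgebra I G` of `G`, with its usual (norm)
topology; the tangent space `𝔤` of `G` at the identity is the model space `E` by definition. For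
finite-dimensional `𝔤` every linear functional is continuous, and the topology is the canonical one
of a finite-dimensional vector space. -/
abbrev LieDual (_I : ModelWithCorners 𝕜 E H) (G : Type*) [TopologicalSpace G] [ChartedSpace H G]
    [Group G] : Type _ :=
  E →L[𝕜] 𝕜

variable {G} in
/-- The adjoint action `Ad(g) : 𝔤 → 𝔤`, the differential at the identity of the conjugation
`h ↦ g * h * g⁻¹`. -/
def Ad (g : G) : GroupLieAlgebra I G →L[𝕜] GroupLieAlgebra I G :=
  mfderiv I I (fun h : G => g * h * g⁻¹) 1

variable {G} in
/-- The coadjoint action of `G` on `𝔤*`, given by `⟨Ad*(g) ξ, x⟩ = ⟨ξ, Ad(g⁻¹) x⟩`. -/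
def coAd (g : G) (ξ : LieDual I G) : LieDual I G :=
  ξ.comp (Ad I g⁻¹)

/-- The coadjoint orbit of `ξ`. -/
def orbit (ξ : LieDual I G) : Set (LieDual I G) :=
  Set.range fun g : G => coAd I g ξ

/-- The tangent space at `η` of the coadjoint orbit through `η`: the orbit is an immersed
submanifold of `𝔤*` by the identification `G / G_η ≃ orbit`, so its tangent space at `η` is the
image of the differential at the identity of the orbit map `g ↦ Ad*(g) η`. -/
def orbitTangentSpace (η : LieDual I G) : Submodule 𝕜 (LieDual I G) :=
  LinearMap.range
    (mfderiv I 𝓘(𝕜, LieDual I G) (fun g : G => coAd I g η) 1 : E →L[𝕜] LieDual I G).toLinearMap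

/-- The set `Ξ_d` of all functionals in `𝔤*` whose coadjoint orbit has dimension `d`, that is, all
tangent spaces of the orbit have dimension `d`. -/
def orbitDimEq (d : ℕ) : Set (LieDual I G) :=
  {ξ | ∀ η ∈ orbit I G ξ, Module.finrank 𝕜 (orbitTangentSpace I G η) = d}

/-- The stabilizer `𝔤(ξ) = {x ∈ 𝔤 | ⟨ξ, [x, y]⟩ = 0 for all y ∈ 𝔤}` of `ξ ∈ 𝔤*` for the coadjoint
action of the Lie algebra `𝔤`, as a point of the Grassmann manifold of `𝔤`. -/
def stabilizer [FiniteDimensional 𝕜 E] [LieGroup I (minSmoothness 𝕜 3) G] (ξ : LieDual I G) :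
    Gr 𝕜 (GroupLieAlgebra I G) :=
  haveI : CompleteSpace E := FiniteDimensional.complete 𝕜 E
  show Submodule 𝕜 (GroupLieAlgebra I G) from
  { carrier := {x | ∀ y : GroupLieAlgebra I G, ξ (⁅x, y⁆ : GroupLieAlgebra I G) = 0}
    zero_mem' := fun y => by
      rw [zero_lie]; exact map_zero ξ
    add_mem' := fun {a b} ha hb y => by
      rw [add_lie]; exact (map_add ξ _ _).trans (by rw [ha y, hb y, add_zero])
    smul_mem' := fun c x hx y => by
      rw [smul_lie]; exact (map_smul ξ c _).trans (by rw [hx y, smul_zero]) }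

end Coadjoint

end

/-! Everything is read off from the alternating form B_ξ(x, y) = ξ([x, y]), which depends
continuously on ξ. Its kernel is 𝔤(ξ), and its range is the tangent space at ξ of the coadjoint
orbit, so orbit dimension and dim 𝔤(ξ) add up to m.

Kernels of a continuous family of linear maps vary continuously exactly when their dimension is
locally constant (`Gr.continuous_iff_isLocallyConstant_finrank`). Hence continuity means that the
rank of B_ξ is locally constant on Ξ. As the rank takes finitely many values, this says that its
fibres are closed; the odd ones are empty because alternating forms have even rank.

The analytic work is the tangent space. In the chart at 1, the bracket is the antisymmetrized mixed
second derivative of the multiplication; differentiating L_g ∘ Ad(g⁻¹) = R_g there gives -ad as the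
derivative of Ad(g⁻¹) at 1. Thus the orbit map of η has derivative -B_η
(`Coadjoint.hasMFDerivAt_coAd`), and equivariance makes the rank constant along orbits. -/

/-! ### Alternating forms have even rank -/

theorem LinearMap.IsAlt.even_finrank_of_separatingLeft {K V : Type*} [Field K] [CharZero K]
    [AddCommGroup V] [Module K V] [FiniteDimensional K V] {B : LinearMap.BilinForm K V}
    (hB : B.IsAlt) (h : B.SeparatingLeft) : Even (Module.finrank K V) := by
  by_contra hodd
  rw [Nat.not_even_iff_odd] at hodd
  let b := Module.finBasis K V
  have hnd : B.Nondegenerate := (LinearMap.IsRefl.nondegenerate_iff_separatingLeft hB.isRefl).2 h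
  have hdet := (LinearMap.BilinForm.nondegenerate_iff_det_ne_zero b).1 hnd
  -- In odd size, a skew-symmetric Gram matrix has det = -det, hence det = 0 in characteristic zero.
  have hskew : (LinearMap.BilinForm.toMatrix b B).transpose = -LinearMap.BilinForm.toMatrix b B := by
    ext i j
    simpa [LinearMap.BilinForm.toMatrix_apply] using (LinearMap.IsAlt.neg hB _ _).symm
  have h1 := congrArg Matrix.det hskew
  rw [Matrix.det_transpose, Matrix.det_neg, Fintype.card_fin, hodd.neg_one_pow, neg_one_mul,
    self_eq_neg] at h1
  exact hdet h1

/-- The rank of an alternating bilinear form is even. -/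
theorem LinearMap.IsAlt.even_finrank_range {K V : Type*} [Field K] [CharZero K]
    [AddCommGroup V] [Module K V] [FiniteDimensional K V] {B : LinearMap.BilinForm K V}
    (hB : B.IsAlt) : Even (Module.finrank K (LinearMap.range B)) := by
  obtain ⟨W, hW⟩ := (LinearMap.ker B).exists_isCompl
  have hdim : Module.finrank K (LinearMap.range B) = Module.finrank K W := by
    have h1 := Submodule.finrank_add_eq_of_isCompl hW
    have h2 := LinearMap.finrank_range_add_finrank_ker B
    omega
  rw [hdim]
  -- On a complement W of the kernel the form stays nondegenerate: a vector of W orthogonal to W is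
  -- also orthogonal to the kernel.
  refine LinearMap.IsAlt.even_finrank_of_separatingLeft (B := B.domRestrict₁₂ W W)
    (fun x => hB x) fun x hx => ?_
  have hxk : (x : V) ∈ LinearMap.ker B := by
    rw [LinearMap.mem_ker]
    ext y
    have hy : y ∈ LinearMap.ker B ⊔ W := by rw [hW.sup_eq_top]; trivial
    obtain ⟨k, hk, w, hw, rfl⟩ := Submodule.mem_sup.1 hy
    have h1 : B x k = 0 := by
      rw [hB.eq_iff, LinearMap.mem_ker.1 hk, LinearMap.zero_apply]
    have h2 : B x w = 0 := hx ⟨w, hw⟩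
    simp [h1, h2]
  exact Subtype.ext ((Submodule.disjoint_def.1 hW.disjoint) x hxk x.2)

/-! ### Continuity of kernels in the Grassmannian -/

namespace Gr

variable {𝕜 E : Type*} [RCLike 𝕜] [NormedAddCommGroup E] [NormedSpace 𝕜 E]

theorem continuous_ofFrame (k : ℕ) : Continuous (ofFrame 𝕜 E k) := by
  rw [continuous_iff_coinduced_le]
  exact le_iSup (fun k : ℕ => TopologicalSpace.coinduced (ofFrame 𝕜 E k) inferInstance) k

theorem isOpen_iff {U : Set (Gr 𝕜 E)} : IsOpen U ↔ ∀ k, IsOpen (ofFrame 𝕜 E k ⁻¹' U) := by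
  rw [isOpen_iSup_iff]
  exact forall_congr' fun k => isOpen_coinduced

/-- The dimension of a point of the Grassmann manifold. -/
noncomputable def finrank {𝕜 V : Type*} [Field 𝕜] [AddCommGroup V] [Module 𝕜 V] (S : Gr 𝕜 V) : ℕ :=
  Module.finrank 𝕜 (id S : Submodule 𝕜 V)

/-- The dimension is locally constant on the Grassmann manifold. -/
theorem isLocallyConstant_finrank :
    IsLocallyConstant fun S : Gr 𝕜 E => finrank S := by
  rw [IsLocallyConstant.iff_isOpen_fiber]
  intro d
  rw [isOpen_iff]
  intro k
  have h : ∀ f : Frame 𝕜 E k,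
      finrank (ofFrame 𝕜 E k f) = k := fun f => (finrank_span_eq_card f.2).trans (Fintype.card_fin k)
  by_cases hk : k = d
  · convert! isOpen_univ
    ext f
    simp [h f, hk]
  · convert! isOpen_empty
    ext f
    simp [h f, hk]

variable {F X : Type*} [NormedAddCommGroup F] [NormedSpace 𝕜 F] [TopologicalSpace X]
  [FiniteDimensional 𝕜 E] [FiniteDimensional 𝕜 F]

/-- Near a point of a continuous family of linear maps whose kernels all have the same dimension,
the kernels are spanned by a continuous family of frames. -/
theorem exists_continuousOn_frame_ker (B : X → E →L[𝕜] F) (hB : Continuous B) (x₀ : X)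
    (hloc : ∀ᶠ x in nhds x₀, Module.finrank 𝕜 (LinearMap.ker (B x).toLinearMap) =
      Module.finrank 𝕜 (LinearMap.ker (B x₀).toLinearMap)) :
    ∃ f : X → Fin (Module.finrank 𝕜 (LinearMap.ker (B x₀).toLinearMap)) → E,
      ∃ s ∈ nhds x₀, ContinuousOn f s ∧ ∀ x ∈ s, LinearIndependent 𝕜 (f x) ∧
        Submodule.span 𝕜 (Set.range (f x)) = LinearMap.ker (B x).toLinearMap := by
  have : CompleteSpace E := FiniteDimensional.complete 𝕜 E
  set V := LinearMap.ker (B x₀).toLinearMap with hV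
  set R := LinearMap.range (B x₀).toLinearMap with hR
  obtain ⟨P, hP⟩ := LinearMap.exists_leftInverse_of_injective V.subtype V.ker_subtype
  obtain ⟨Q, hQ⟩ := LinearMap.exists_leftInverse_of_injective R.subtype R.ker_subtype
  -- With projections P onto V and Q onto R, the map (P, Q ∘ B x) is invertible at x₀, hence nearby.
  -- It sends ker (B x) into V × 0, so pulling back a basis of V × 0 gives the frame.
  let T : X → E →L[𝕜] V × R := fun x =>
    (LinearMap.toContinuousLinearMap P).prod ((LinearMap.toContinuousLinearMap Q).comp (B x))
  have hTapp : ∀ x y, T x y = (P y, Q (B x y)) := fun x y => rfl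
  have hT : Continuous T := by
    have h1 : Continuous fun x => (LinearMap.toContinuousLinearMap Q).comp (B x) :=
      continuous_const.clm_comp hB
    exact (ContinuousLinearMap.prodₗᵢ (𝕜 := 𝕜) (E := E) (F := V) (G := R) 𝕜).continuous.comp
      (continuous_const.prodMk h1)
  have hinj : Function.Injective (T x₀).toLinearMap := by
    rw [← LinearMap.ker_eq_bot, LinearMap.ker_eq_bot']
    intro y hy
    obtain ⟨h1, h2⟩ := Prod.mk.inj ((hTapp x₀ y).symm.trans hy)
    have h3 : Q (B x₀ y) = ⟨B x₀ y, y, rfl⟩ := LinearMap.congr_fun hQ ⟨B x₀ y, y, rfl⟩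
    have h4 : y ∈ V := congrArg Subtype.val (h3.symm.trans h2)
    have h5 : P y = ⟨y, h4⟩ := LinearMap.congr_fun hP ⟨y, h4⟩
    exact congrArg Subtype.val (h5.symm.trans h1)
  have hdim : Module.finrank 𝕜 E = Module.finrank 𝕜 (V × R) := by
    rw [Module.finrank_prod, add_comm]
    exact (LinearMap.finrank_range_add_finrank_ker (B x₀).toLinearMap).symm
  let e : E ≃L[𝕜] V × R :=
    (LinearEquiv.ofInjectiveOfFinrankEq (T x₀).toLinearMap hinj hdim).toContinuousLinearEquiv
  have he : (e : E →L[𝕜] V × R) = T x₀ := by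
    ext y <;> rfl
  have hs : ∀ᶠ x in nhds x₀, (T x).IsInvertible := by
    have h1 := e.nhds
    rw [he] at h1
    exact hT.continuousAt.eventually h1
  let b := Module.finBasis 𝕜 V
  refine ⟨fun x i => (T x).inverse (b i, 0), _, hs.and hloc, ?_, ?_⟩
  · rintro x ⟨hx, -⟩
    have h1 : ContinuousAt (fun x => (T x).inverse) x :=
      ContinuousAt.comp (f := T) (x := x) (hx.contDiffAt_map_inverse (n := 0)).continuousAt
        hT.continuousAt
    exact (continuousAt_pi.2 fun i => h1.clm_apply continuousAt_const).continuousWithinAt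
  · rintro x ⟨⟨g, hg⟩, hx⟩
    have hli : LinearIndependent 𝕜 fun i => (T x).inverse (b i, 0) := by
      rw [← hg, ContinuousLinearMap.inverse_equiv]
      exact (b.linearIndependent.map' (LinearMap.inl 𝕜 V R)
        (LinearMap.ker_eq_bot.2 LinearMap.inl_injective)).map'
        g.symm.toLinearEquiv.toLinearMap g.symm.toLinearEquiv.ker
    -- Only the inclusion of ker (B x) in the span is automatic; the constant dimension forces
    -- equality.
    refine ⟨hli, Eq.symm (Submodule.eq_of_le_of_finrank_eq ?_ ?_)⟩
    · intro y hy
      have h1 : g y = (P y, 0) := by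
        have h0 : B x y = 0 := hy
        have : g y = T x y := by rw [← hg]; rfl
        rw [this, hTapp, h0, map_zero]
      have h2 : y = g.symm (LinearMap.inl 𝕜 V R (P y)) := by
        rw [LinearMap.inl_apply, ← h1, g.symm_apply_apply]
      rw [h2, ← b.sum_repr (P y)]
      simp only [map_sum, map_smul]
      refine Submodule.sum_mem _ fun i _ => Submodule.smul_mem _ _ (Submodule.subset_span ⟨i, ?_⟩)
      simp only [← hg, ContinuousLinearMap.inverse_equiv]
      rfl
    · rw [hx, finrank_span_eq_card hli, Fintype.card_fin]

/-- The kernel of a continuous family of linear maps varies continuously if and only if its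
dimension is locally constant. -/
theorem continuous_iff_isLocallyConstant_finrank (B : X → E →L[𝕜] F) (hB : Continuous B)
    (S : X → Gr 𝕜 E) (hS : ∀ x, S x = LinearMap.ker (B x).toLinearMap) :
    Continuous S ↔ IsLocallyConstant fun x => finrank (S x) := by
  refine ⟨fun h => (isLocallyConstant_finrank (𝕜 := 𝕜) (E := E)).comp_continuous h, fun h => ?_⟩
  refine continuous_iff_continuousAt.2 fun x₀ => ?_
  have hloc := (IsLocallyConstant.iff_eventually_eq _).1 h x₀
  simp only [hS] at hloc
  obtain ⟨f, s, hs, hf, hfs⟩ := exists_continuousOn_frame_ker B hB x₀ hloc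
  suffices hS' : ContinuousOn S s from hS'.continuousAt hs
  rw [continuousOn_iff_continuous_domRestrict] at hf ⊢
  have h1 := (continuous_ofFrame _).comp
    (hf.subtype_mk fun x : s => (hfs x.1 x.2).1)
  convert! h1 using 1
  ext1 x
  exact (hS x).trans (hfs x.1 x.2).2.symm

end Gr

/-! ### Differential calculus -/

open VectorField

/-- Units are open, so A = P⁻¹Q near e and differentiability of A need not be assumed. Inversion has
derivative -id at 1. -/
theorem HasFDerivAt.of_mul_eventuallyEq {𝕜 E R : Type*} [NontriviallyNormedField 𝕜]
    [NormedAddCommGroup E] [NormedSpace 𝕜 E] [NormedRing R] [NormedAlgebra 𝕜 R]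
    [CompleteSpace R] {P Q A : E → R} {P' Q' : E →L[𝕜] R} {e : E}
    (hP : HasFDerivAt P P' e) (hQ : HasFDerivAt Q Q' e) (hPe : P e = 1) (hQe : Q e = 1)
    (h : ∀ᶠ x in nhds e, P x * A x = Q x) : HasFDerivAt A (Q' - P') e := by
  have hinv : HasFDerivAt Ring.inverse (-ContinuousLinearMap.mulLeftRight 𝕜 R 1 1) (P e) := by
    simpa [hPe] using hasFDerivAt_ringInverse (𝕜 := 𝕜) (1 : Rˣ)
  have h1 := (hinv.comp e hP).mul' hQ
  have hunit : ∀ᶠ x in nhds e, IsUnit (P x) :=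
    hP.continuousAt.eventually (by rw [hPe]; exact Units.isOpen.mem_nhds isUnit_one)
  refine (h1.congr_of_eventuallyEq ?_).congr_fderiv ?_
  · filter_upwards [h, hunit] with x hx hu
    simp [← hx, Ring.inverse_mul_cancel_left _ _ hu]
  · ext v
    simp [hPe, hQe, sub_eq_add_neg]

section PartialDerivatives

variable {𝕜 E : Type*} [RCLike 𝕜] [NormedAddCommGroup E] [NormedSpace 𝕜 E]

theorem ContDiffAt.hasFDerivAt_fderiv_comp_inr {f : E × E → E} {e : E}
    (hf : ContDiffAt 𝕜 2 f (e, e)) :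
    HasFDerivAt (fun x => (fderiv 𝕜 f (x, e)).comp (ContinuousLinearMap.inr 𝕜 E E))
      (((ContinuousLinearMap.compL 𝕜 E (E × E) E).flip (ContinuousLinearMap.inr 𝕜 E E)).comp
        ((fderiv 𝕜 (fderiv 𝕜 f) (e, e)).comp (ContinuousLinearMap.inl 𝕜 E E))) e := by
  have h1 : HasFDerivAt (fderiv 𝕜 f) (fderiv 𝕜 (fderiv 𝕜 f) (e, e)) (e, e) :=
    ((hf.fderiv_right (m := 1) le_rfl).differentiableAt one_ne_zero).hasFDerivAt
  have h2 : HasFDerivAt (fun x => fderiv 𝕜 f (x, e))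
      ((fderiv 𝕜 (fderiv 𝕜 f) (e, e)).comp (ContinuousLinearMap.inl 𝕜 E E)) e :=
    HasFDerivAt.comp (f := fun x => (x, e)) e h1 (hasFDerivAt_prodMk_left e e)
  exact ((ContinuousLinearMap.compL 𝕜 E (E × E) E).flip
    (ContinuousLinearMap.inr 𝕜 E E)).hasFDerivAt.comp e h2

theorem ContDiffAt.hasFDerivAt_fderiv_comp_inl {f : E × E → E} {e : E}
    (hf : ContDiffAt 𝕜 2 f (e, e)) :
    HasFDerivAt (fun x => (fderiv 𝕜 f (e, x)).comp (ContinuousLinearMap.inl 𝕜 E E))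
      (((ContinuousLinearMap.compL 𝕜 E (E × E) E).flip (ContinuousLinearMap.inl 𝕜 E E)).comp
        ((fderiv 𝕜 (fderiv 𝕜 f) (e, e)).comp (ContinuousLinearMap.inr 𝕜 E E))) e := by
  have h1 : HasFDerivAt (fderiv 𝕜 f) (fderiv 𝕜 (fderiv 𝕜 f) (e, e)) (e, e) :=
    ((hf.fderiv_right (m := 1) le_rfl).differentiableAt one_ne_zero).hasFDerivAt
  have h2 : HasFDerivAt (fun x => fderiv 𝕜 f (e, x))
      ((fderiv 𝕜 (fderiv 𝕜 f) (e, e)).comp (ContinuousLinearMap.inr 𝕜 E E)) e :=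
    HasFDerivAt.comp (f := fun x => (e, x)) e h1 (hasFDerivAt_prodMk_right e e)
  exact ((ContinuousLinearMap.compL 𝕜 E (E × E) E).flip
    (ContinuousLinearMap.inl 𝕜 E E)).hasFDerivAt.comp e h2

end PartialDerivatives

/-- The base point y is only propositionally equal to f x, which accommodates points such as g * 1 *
g⁻¹ = 1; derivatives are typed on the model spaces. -/
theorem HasMFDerivAt.comp_of_apply_eq {𝕜 : Type*} [NontriviallyNormedField 𝕜]
    {E E' E'' : Type*} [NormedAddCommGroup E] [NormedSpace 𝕜 E] [NormedAddCommGroup E']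
    [NormedSpace 𝕜 E'] [NormedAddCommGroup E''] [NormedSpace 𝕜 E'']
    {H H' H'' : Type*} [TopologicalSpace H] [TopologicalSpace H'] [TopologicalSpace H'']
    {I : ModelWithCorners 𝕜 E H} {I' : ModelWithCorners 𝕜 E' H'} {I'' : ModelWithCorners 𝕜 E'' H''}
    {M M' M'' : Type*} [TopologicalSpace M] [ChartedSpace H M] [TopologicalSpace M']
    [ChartedSpace H' M'] [TopologicalSpace M''] [ChartedSpace H'' M'']
    {g : M' → M''} {f : M → M'} {x : M} {y : M'} {g' : E' →L[𝕜] E''} {f' : E →L[𝕜] E'}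
    (hg : HasMFDerivAt I' I'' g y g') (hy : f x = y) (hf : HasMFDerivAt I I' f x f') :
    HasMFDerivAt I I'' (g ∘ f) x (g'.comp f') := by
  subst hy
  exact hg.comp x hf

/-! ### The multiplication and the Lie bracket in the chart at the identity -/

namespace LieGroup

variable {𝕜 : Type*} [RCLike 𝕜] {E : Type*} [NormedAddCommGroup E] [NormedSpace 𝕜 E]
  {H : Type*} [TopologicalSpace H] (I : ModelWithCorners 𝕜 E H)
  (G : Type*) [TopologicalSpace G] [ChartedSpace H G] [Group G]

/-- The multiplication of a Lie group, read in the chart at the identity. -/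
noncomputable def chartMul (p : E × E) : E :=
  extChartAt I (1 : G) ((extChartAt I (1 : G)).symm p.1 * (extChartAt I (1 : G)).symm p.2)

/-- The coordinates of the identity. -/
noncomputable def chartOne : E := extChartAt I (1 : G) 1

theorem extChartAt_symm_chartOne : (extChartAt I (1 : G)).symm (chartOne I G) = 1 :=
  extChartAt_to_inv 1

/-- The derivative of `chartMul` in the second variable at the identity. -/
noncomputable def chartLeft (x : E) : E →L[𝕜] E :=
  (fderiv 𝕜 (chartMul I G) (x, chartOne I G)).comp (ContinuousLinearMap.inr 𝕜 E E)

/-- The derivative of `chartMul` in the first variable at the identity. -/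
noncomputable def chartRight (x : E) : E →L[𝕜] E :=
  (fderiv 𝕜 (chartMul I G) (chartOne I G, x)).comp (ContinuousLinearMap.inl 𝕜 E E)

variable [LieGroup I (minSmoothness 𝕜 3) G]

theorem hasMFDerivAt_extChartAt_of_mem_target {x : E}
    (hx : x ∈ (extChartAt I (1 : G)).target) :
    HasMFDerivAt I 𝓘(𝕜, E) (extChartAt I (1 : G)) ((extChartAt I (1 : G)).symm x)
      (mfderiv I 𝓘(𝕜, E) (extChartAt I (1 : G)) ((extChartAt I (1 : G)).symm x)) := by
  have : IsManifold I 1 G := .of_le (n := minSmoothness 𝕜 3) (le_trans (by norm_num) le_minSmoothness)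
  refine (mdifferentiableAt_extChartAt ?_).hasMFDerivAt
  rw [← extChartAt_source (I := I)]
  exact (extChartAt I (1 : G)).map_target hx

theorem hasMFDerivAt_mul_left (g h : G) :
    HasMFDerivAt I I (fun k : G => g * k) h (mfderiv I I (fun k : G => g * k) h) :=
  ((contMDiff_mul_left (n := minSmoothness 𝕜 3)).contMDiffAt.mdifferentiableAt
    (lt_of_lt_of_le (by simp) le_minSmoothness).ne').hasMFDerivAt

theorem hasMFDerivAt_mul_right (g h : G) :
    HasMFDerivAt I I (fun k : G => k * g) h (mfderiv I I (fun k : G => k * g) h) :=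
  ((contMDiff_mul_right (n := minSmoothness 𝕜 3)).contMDiffAt.mdifferentiableAt
    (lt_of_lt_of_le (by simp) le_minSmoothness).ne').hasMFDerivAt

variable [I.Boundaryless]

theorem contDiffAt_chartMul :
    ContDiffAt 𝕜 (minSmoothness 𝕜 3) (chartMul I G) (chartOne I G, chartOne I G) := by
  have hs : ContMDiffAt 𝓘(𝕜, E) I (minSmoothness 𝕜 3) (extChartAt I (1 : G)).symm (chartOne I G) :=
    (contMDiffOn_extChartAt_symm (1 : G)).contMDiffAt (extChartAt_target_mem_nhds (1 : G))
  have h1 : ContMDiffAt 𝓘(𝕜, E × E) I (minSmoothness 𝕜 3)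
      (fun p : E × E => (extChartAt I (1 : G)).symm p.1 * (extChartAt I (1 : G)).symm p.2)
      (chartOne I G, chartOne I G) :=
    ContMDiffAt.mul
      (hs.comp (chartOne I G, chartOne I G) contDiff_fst.contMDiff.contMDiffAt)
      (hs.comp (chartOne I G, chartOne I G) contDiff_snd.contMDiff.contMDiffAt)
  have h2 : ContMDiffAt I 𝓘(𝕜, E) (minSmoothness 𝕜 3) (extChartAt I (1 : G))
      ((extChartAt I (1 : G)).symm (chartOne I G) * (extChartAt I (1 : G)).symm (chartOne I G)) := by
    rw [extChartAt_symm_chartOne, mul_one]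
    exact contMDiffAt_extChartAt
  exact (ContMDiffAt.comp (chartOne I G, chartOne I G) h2 h1).contDiffAt

theorem hasMFDerivAt_extChartAt_symm_chartOne :
    HasMFDerivAt 𝓘(𝕜, E) I (extChartAt I (1 : G)).symm (chartOne I G)
      (ContinuousLinearMap.id 𝕜 E) := by
  have : IsManifold I 1 G := .of_le (n := minSmoothness 𝕜 3) (le_trans (by norm_num) le_minSmoothness)
  have h1 : MDifferentiableAt 𝓘(𝕜, E) I (extChartAt I (1 : G)).symm (chartOne I G) := by
    rw [← mdifferentiableWithinAt_univ, ← I.range_eq_univ]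
    exact mdifferentiableWithinAt_extChartAt_symm (mem_extChartAt_target 1)
  have h2 := mfderivWithin_range_extChartAt_symm (I := I) (x := (1 : G))
  rw [I.range_eq_univ, mfderivWithin_univ] at h2
  have h3 := h1.hasMFDerivAt
  rw [chartOne, h2] at h3
  exact h3

theorem eventually_differentiableAt_chartMul :
    ∀ᶠ p in nhds (chartOne I G, chartOne I G), DifferentiableAt 𝕜 (chartMul I G) p := by
  have h1 : ContDiffAt 𝕜 1 (chartMul I G) (chartOne I G, chartOne I G) :=
    (contDiffAt_chartMul I G).of_le (le_trans (by norm_num) le_minSmoothness)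
  exact (h1.eventually (by simp)).mono fun p hp => hp.differentiableAt one_ne_zero

/-- Chain rule; the inverse chart has derivative id at the coordinates of 1. The outer chart factor
is the same as for `chartRight`, so relations between left and right translations carry over. -/
theorem chartLeft_eventuallyEq : ∀ᶠ x in nhds (chartOne I G),
    chartLeft I G x =
      (mfderiv I 𝓘(𝕜, E) (extChartAt I (1 : G)) ((extChartAt I (1 : G)).symm x) : E →L[𝕜] E).comp
        (mfderiv I I (fun h : G => (extChartAt I (1 : G)).symm x * h) 1 : E →L[𝕜] E) := by
  have hc : Filter.Tendsto (fun x : E => (x, chartOne I G)) (nhds (chartOne I G))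
      (nhds (chartOne I G, chartOne I G)) := (Continuous.prodMk_left _).continuousAt
  filter_upwards [hc.eventually (eventually_differentiableAt_chartMul I G),
    extChartAt_target_mem_nhds (I := I) (1 : G)] with x hx hxt
  have h1 : HasFDerivAt (fun y => chartMul I G (x, y)) (chartLeft I G x) (chartOne I G) :=
    HasFDerivAt.comp (f := fun y => (x, y)) _ hx.hasFDerivAt (hasFDerivAt_prodMk_right x (chartOne I G))
  have h2 := HasMFDerivAt.comp_of_apply_eq
    (f := (fun h : G => (extChartAt I (1 : G)).symm x * h) ∘ (extChartAt I (1 : G)).symm)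
    (hasMFDerivAt_extChartAt_of_mem_target I G hxt)
    (by rw [Function.comp_apply, extChartAt_symm_chartOne]; simp)
    (HasMFDerivAt.comp_of_apply_eq (hasMFDerivAt_mul_left I G ((extChartAt I (1 : G)).symm x) 1)
      (extChartAt_symm_chartOne I G) (hasMFDerivAt_extChartAt_symm_chartOne I G))
  exact h1.unique h2.hasFDerivAt

theorem chartRight_eventuallyEq : ∀ᶠ x in nhds (chartOne I G),
    chartRight I G x =
      (mfderiv I 𝓘(𝕜, E) (extChartAt I (1 : G)) ((extChartAt I (1 : G)).symm x) : E →L[𝕜] E).comp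
        (mfderiv I I (fun h : G => h * (extChartAt I (1 : G)).symm x) 1 : E →L[𝕜] E) := by
  have hc : Filter.Tendsto (fun x : E => (chartOne I G, x)) (nhds (chartOne I G))
      (nhds (chartOne I G, chartOne I G)) := (Continuous.prodMk_right _).continuousAt
  filter_upwards [hc.eventually (eventually_differentiableAt_chartMul I G),
    extChartAt_target_mem_nhds (I := I) (1 : G)] with x hx hxt
  have h1 : HasFDerivAt (fun y => chartMul I G (y, x)) (chartRight I G x) (chartOne I G) :=
    HasFDerivAt.comp (f := fun y => (y, x)) _ hx.hasFDerivAt (hasFDerivAt_prodMk_left (chartOne I G) x)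
  have h2 := HasMFDerivAt.comp_of_apply_eq
    (f := (fun h : G => h * (extChartAt I (1 : G)).symm x) ∘ (extChartAt I (1 : G)).symm)
    (hasMFDerivAt_extChartAt_of_mem_target I G hxt)
    (by rw [Function.comp_apply, extChartAt_symm_chartOne]; simp)
    (HasMFDerivAt.comp_of_apply_eq (hasMFDerivAt_mul_right I G ((extChartAt I (1 : G)).symm x) 1)
      (extChartAt_symm_chartOne I G) (hasMFDerivAt_extChartAt_symm_chartOne I G))
  exact h1.unique h2.hasFDerivAt

theorem chartLeft_chartOne : chartLeft I G (chartOne I G) = ContinuousLinearMap.id 𝕜 E := by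
  have h0 : HasFDerivAt (fun y => chartMul I G (chartOne I G, y)) (chartLeft I G (chartOne I G))
      (chartOne I G) :=
    HasFDerivAt.comp (f := fun y => (chartOne I G, y)) _
      (eventually_differentiableAt_chartMul I G).self_of_nhds.hasFDerivAt
      (hasFDerivAt_prodMk_right _ _)
  refine h0.unique ((hasFDerivAt_id _).congr_of_eventuallyEq ?_)
  filter_upwards [extChartAt_target_mem_nhds (I := I) (1 : G)] with y hy
  rw [chartMul, extChartAt_symm_chartOne, one_mul, (extChartAt I (1 : G)).right_inv hy, id]

theorem chartRight_chartOne : chartRight I G (chartOne I G) = ContinuousLinearMap.id 𝕜 E := by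
  have h0 : HasFDerivAt (fun y => chartMul I G (y, chartOne I G)) (chartRight I G (chartOne I G))
      (chartOne I G) :=
    HasFDerivAt.comp (f := fun y => (y, chartOne I G)) _
      (eventually_differentiableAt_chartMul I G).self_of_nhds.hasFDerivAt
      (hasFDerivAt_prodMk_left _ _)
  refine h0.unique ((hasFDerivAt_id _).congr_of_eventuallyEq ?_)
  filter_upwards [extChartAt_target_mem_nhds (I := I) (1 : G)] with y hy
  rw [chartMul, extChartAt_symm_chartOne, mul_one, (extChartAt I (1 : G)).right_inv hy, id]

/-- The second derivative of the multiplication at the identity, in the chart at the identity. -/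
noncomputable def chartMulSnd : E × E →L[𝕜] E × E →L[𝕜] E :=
  fderiv 𝕜 (fderiv 𝕜 (chartMul I G)) (chartOne I G, chartOne I G)

theorem contDiffAt_two_chartMul :
    ContDiffAt 𝕜 2 (chartMul I G) (chartOne I G, chartOne I G) :=
  (contDiffAt_chartMul I G).of_le (le_trans (by norm_num) le_minSmoothness)

theorem chartMulSnd_symm (p q : E × E) : chartMulSnd I G p q = chartMulSnd I G q p :=
  ((contDiffAt_chartMul I G).isSymmSndFDerivAt (minSmoothness_monotone (by norm_num))).eq p q

/-- In the chart at the identity, the Lie bracket is the antisymmetrization of the mixed second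
derivative of the multiplication. -/
theorem bracket_eq_chartMulSnd (v w : GroupLieAlgebra I G) :
    (⁅v, w⁆ : GroupLieAlgebra I G) =
      (chartMulSnd I G ((v : E), 0) (0, (w : E)) - chartMulSnd I G ((w : E), 0) (0, (v : E)) : E) := by
  have : IsManifold I 1 G :=
    .of_le (n := minSmoothness 𝕜 3) (le_trans (by norm_num) le_minSmoothness)
  -- In the chart, the left-invariant field of u is x ↦ `chartLeft` x u.
  have hfield : ∀ u : GroupLieAlgebra I G,
      (mpullbackWithin 𝓘(𝕜, E) I (extChartAt I (1 : G)).symm (mulInvariantVectorField u)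
        (Set.range I)) =ᶠ[nhds (chartOne I G)] fun x => chartLeft I G x (u : E) := by
    intro u
    filter_upwards [chartLeft_eventuallyEq I G, extChartAt_target_mem_nhds (I := I) (1 : G)]
      with x hx hxt
    rw [mpullbackWithin_apply, hx, ContinuousLinearMap.inverse_eq
      (mfderivWithin_extChartAt_symm_comp_mfderiv_extChartAt hxt)
      (mfderiv_extChartAt_comp_mfderivWithin_extChartAt_symm hxt)]
    rfl
  have hderiv : ∀ u z : E, fderiv 𝕜 (fun x => chartLeft I G x u) (chartOne I G) z =
      chartMulSnd I G (z, 0) (0, u) := fun u z => by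
    have h1 : HasFDerivAt (fun x => chartLeft I G x u) _ (chartOne I G) :=
      (contDiffAt_two_chartMul I G).hasFDerivAt_fderiv_comp_inr.clm_apply
        (hasFDerivAt_const u (chartOne I G))
    rw [h1.fderiv, ContinuousLinearMap.comp_zero, zero_add]
    rfl
  -- The set s stands for the domain in the definition of the bracket, which is all of E since the
  -- model is boundaryless.
  have hbr : ∀ (v w : E) (V W : E → E) (s : Set E), s = Set.univ →
      V =ᶠ[nhds (chartOne I G)] (fun x => chartLeft I G x v) →
      W =ᶠ[nhds (chartOne I G)] (fun x => chartLeft I G x w) →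
      lieBracketWithin 𝕜 V W s (chartOne I G) =
        chartMulSnd I G (v, 0) (0, w) - chartMulSnd I G (w, 0) (0, v) := by
    rintro v w V W s rfl hV hW
    rw [lieBracketWithin_univ, hV.lieBracket_vectorField_eq hW, lieBracket,
      hderiv, hderiv, chartLeft_chartOne]
    rfl
  have hinv : ∀ T : E →L[𝕜] E, T = ContinuousLinearMap.id 𝕜 E → ∀ z, T.inverse z = z := by
    rintro _ rfl z
    simp
  exact (hinv _ mfderiv_extChartAt_self _).trans
    (hbr v w _ _ _ (by simp [I.range_eq_univ]) (hfield v) (hfield w))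

end LieGroup


/-! ### The coadjoint action, its orbits and their tangent spaces -/

namespace Coadjoint

variable {𝕜 : Type*} [RCLike 𝕜] {E : Type*} [NormedAddCommGroup E] [NormedSpace 𝕜 E]
  {H : Type*} [TopologicalSpace H] (I : ModelWithCorners 𝕜 E H)
  (G : Type*) [TopologicalSpace G] [ChartedSpace H G] [Group G]

variable {G} in
/-- The adjoint action on the model space. -/
noncomputable def adModel (g : G) : E →L[𝕜] E := Ad I g

variable {G} in
theorem coAd_eq (g : G) (ξ : E →L[𝕜] 𝕜) : coAd I g ξ = ξ.comp (adModel I g⁻¹) := rfl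

/-- The Lie bracket as a continuous bilinear map on the model space. -/
noncomputable def bracketModel : E →L[𝕜] E →L[𝕜] E :=
  let D := (((ContinuousLinearMap.compL 𝕜 E (E × E) E).flip (ContinuousLinearMap.inr 𝕜 E E)).comp
    ((LieGroup.chartMulSnd I G).comp (ContinuousLinearMap.inl 𝕜 E E)))
  D - D.flip

/-- The bilinear form `(x, y) ↦ ξ [x, y]`. -/
noncomputable def kirillovForm (ξ : E →L[𝕜] 𝕜) : E →L[𝕜] E →L[𝕜] 𝕜 :=
  (ContinuousLinearMap.compL 𝕜 E E 𝕜 ξ).comp (bracketModel I G)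

theorem continuous_kirillovForm : Continuous (kirillovForm I G) :=
  ((ContinuousLinearMap.compL 𝕜 E E 𝕜).continuous).clm_comp continuous_const

section Functoriality

variable [LieGroup I (minSmoothness 𝕜 3) G]

variable {G} in
theorem hasMFDerivAt_conj (g h : G) :
    HasMFDerivAt I I (fun k : G => g * k * g⁻¹) h (mfderiv I I (fun k : G => g * k * g⁻¹) h) :=
  (((contMDiff_mul_right (n := minSmoothness 𝕜 3) (a := g⁻¹)).comp
    (contMDiff_mul_left (n := minSmoothness 𝕜 3) (a := g))).contMDiffAt.mdifferentiableAt
    (lt_of_lt_of_le (by simp) le_minSmoothness).ne').hasMFDerivAt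

variable {G} in
theorem hasMFDerivAt_adModel (g : G) :
    HasMFDerivAt I I (fun k : G => g * k * g⁻¹) 1
      (adModel I g : E →L[𝕜] E) :=
  hasMFDerivAt_conj I g 1

theorem adModel_one : adModel I (1 : G) = ContinuousLinearMap.id 𝕜 E := by
  have h1 := hasMFDerivAt_adModel I (1 : G)
  have h2 : HasMFDerivAt I I (fun k : G => 1 * k * 1⁻¹) 1 (ContinuousLinearMap.id 𝕜 E) := by
    have h : (fun k : G => 1 * k * 1⁻¹) = id := by ext k; simp
    rw [h]
    exact hasMFDerivAt_id (I := I) (1 : G)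
  exact hasMFDerivAt_unique h1 h2

variable {G} in
theorem adModel_mul (g h : G) : adModel I (g * h) = (adModel I g).comp (adModel I h) := by
  have h1 := hasMFDerivAt_adModel I (g * h)
  have h2 := HasMFDerivAt.comp_of_apply_eq (E := E) (E' := E) (E'' := E)
    (f := fun k : G => h * k * h⁻¹)
    (hasMFDerivAt_adModel I g) (by simp) (hasMFDerivAt_adModel I h)
  have h3 : (fun k : G => g * k * g⁻¹) ∘ (fun k : G => h * k * h⁻¹) =
      fun k : G => g * h * k * (g * h)⁻¹ := by
    ext k
    simp [mul_assoc]
  rw [h3] at h2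
  exact hasMFDerivAt_unique h1 h2

variable {G} in
-- Differentiate g(g⁻¹kg) = kg at k = 1. This determines Ad(g⁻¹) from the two translations.
theorem mul_left_comp_adModel (g : G) {L R : E →L[𝕜] E}
    (hL : HasMFDerivAt I I (fun h : G => g * h) 1 L)
    (hR : HasMFDerivAt I I (fun h : G => h * g) 1 R) : L.comp (adModel I g⁻¹) = R := by
  have h1 := HasMFDerivAt.comp_of_apply_eq (E := E) (E' := E)
    (f := fun k : G => g⁻¹ * k * g⁻¹⁻¹)
    hL (by simp) (hasMFDerivAt_adModel I g⁻¹)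
  have h3 : (fun k : G => g * k) ∘ (fun k : G => g⁻¹ * k * g⁻¹⁻¹) = fun k : G => k * g := by
    ext k
    simp [mul_assoc]
  rw [h3] at h1
  exact hasMFDerivAt_unique h1 hR

variable {G} in
theorem adModel_surjective (g : G) : Function.Surjective (adModel I g) := fun x =>
  ⟨adModel I g⁻¹ x, by
    rw [← ContinuousLinearMap.comp_apply, ← adModel_mul, mul_inv_cancel, adModel_one,
      ContinuousLinearMap.id_apply]⟩

end Functoriality

variable [I.Boundaryless] [LieGroup I (minSmoothness 𝕜 3) G]

theorem bracketModel_apply (v w : GroupLieAlgebra I G) :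
    bracketModel I G (v : E) (w : E) = (⁅v, w⁆ : GroupLieAlgebra I G) :=
  (LieGroup.bracket_eq_chartMulSnd I G v w).symm

theorem stabilizer_eq_ker [FiniteDimensional 𝕜 E] (ξ : E →L[𝕜] 𝕜) :
    stabilizer I G ξ = LinearMap.ker (kirillovForm I G ξ).toLinearMap := by
  refine Submodule.ext (p := stabilizer I G ξ) fun x => ?_
  have h : ∀ y, kirillovForm I G ξ x y = ξ (⁅x, y⁆ : GroupLieAlgebra I G) := fun y =>
    congrArg ξ (bracketModel_apply I G x y)
  constructor
  · intro hx
    refine ContinuousLinearMap.ext fun y => ?_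
    exact (h y).trans (hx y)
  · intro hx y
    exact (h y).symm.trans (DFunLike.congr_fun hx y)

variable [CompleteSpace E]

/-- In the chart at the identity, the derivative of `g ↦ Ad(g⁻¹)` at the identity is `-ad`. -/
theorem hasFDerivAt_adModel_inv :
    HasFDerivAt (fun x : E => adModel I ((extChartAt I (1 : G)).symm x)⁻¹) (-bracketModel I G)
      (LieGroup.chartOne I G) := by
  have hP := (LieGroup.contDiffAt_two_chartMul I G).hasFDerivAt_fderiv_comp_inr
  have hQ := (LieGroup.contDiffAt_two_chartMul I G).hasFDerivAt_fderiv_comp_inl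
  refine (HasFDerivAt.of_mul_eventuallyEq hP hQ (LieGroup.chartLeft_chartOne I G)
    (LieGroup.chartRight_chartOne I G) ?_).congr_fderiv ?_
  · filter_upwards [LieGroup.chartLeft_eventuallyEq I G, LieGroup.chartRight_eventuallyEq I G]
      with x hL hR
    change (LieGroup.chartLeft I G x).comp (adModel I ((extChartAt I (1 : G)).symm x)⁻¹) =
      LieGroup.chartRight I G x
    have hcomp : ∀ T L R A : E →L[𝕜] E, L.comp A = R → (T.comp L).comp A = T.comp R := by
      rintro T L R A rfl
      rfl
    rw [hL, hR]
    exact hcomp _ _ _ _ (mul_left_comp_adModel I ((extChartAt I (1 : G)).symm x)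
      (LieGroup.hasMFDerivAt_mul_left I G _ 1) (LieGroup.hasMFDerivAt_mul_right I G _ 1))
  · ext v w
    -- Symmetry of the second derivative turns the right-translation term into the swapped
    -- left-translation term.
    have h1 := LieGroup.chartMulSnd_symm I G (0, v) (w, 0)
    change LieGroup.chartMulSnd I G (0, v) (w, 0) - LieGroup.chartMulSnd I G (v, 0) (0, w) =
      -(LieGroup.chartMulSnd I G (v, 0) (0, w) - LieGroup.chartMulSnd I G (w, 0) (0, v))
    rw [h1, neg_sub]

theorem hasMFDerivAt_coAd (η : E →L[𝕜] 𝕜) :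
    HasMFDerivAt I 𝓘(𝕜, E →L[𝕜] 𝕜) (fun g : G => coAd I g η) 1 (-kirillovForm I G η) := by
  have h1 : HasFDerivAt
      (fun x : E => η.comp (adModel I ((extChartAt I (1 : G)).symm x)⁻¹)) _
      (LieGroup.chartOne I G) :=
    (ContinuousLinearMap.compL 𝕜 E E 𝕜 η).hasFDerivAt.comp _ (hasFDerivAt_adModel_inv I G)
  have hφ : HasMFDerivAt I 𝓘(𝕜, E) (extChartAt I (1 : G)) 1 (ContinuousLinearMap.id 𝕜 E) := by
    have : IsManifold I 1 G :=
      .of_le (n := minSmoothness 𝕜 3) (le_trans (by norm_num) le_minSmoothness)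
    have h3 := (mdifferentiableAt_extChartAt (I := I) (mem_chart_source H (1 : G))).hasMFDerivAt
    rw [mfderiv_extChartAt_self] at h3
    exact h3
  have h2 := HasMFDerivAt.comp_of_apply_eq (E := E) (E' := E) (f := extChartAt I (1 : G)) h1.hasMFDerivAt rfl hφ
  refine (h2.congr_of_eventuallyEq ?_).congr_mfderiv ?_
  · filter_upwards [extChartAt_source_mem_nhds (I := I) (1 : G)] with g hg
    simp only [Function.comp_apply, (extChartAt I (1 : G)).left_inv hg]
    rfl
  · refine ContinuousLinearMap.ext fun v => ?_
    change η.comp (-(bracketModel I G (v : E))) = -(η.comp (bracketModel I G (v : E)))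
    rw [ContinuousLinearMap.comp_neg]

theorem orbitTangentSpace_eq (η : E →L[𝕜] 𝕜) :
    orbitTangentSpace I G η = LinearMap.range (kirillovForm I G η).toLinearMap := by
  have h : (mfderiv I 𝓘(𝕜, LieDual I G) (fun g : G => coAd I g η) 1 : E →L[𝕜] LieDual I G) =
    -kirillovForm I G η := (hasMFDerivAt_coAd I G η).mfderiv
  rw [orbitTangentSpace, h]
  exact LinearMap.range_neg _

variable {G} in
-- Differentiate Ad*(k)Ad*(g)ξ = Ad*(g)Ad*(g⁻¹kg)ξ at k = 1; no separate proof that Ad(g) preserves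
-- the bracket is needed.
theorem kirillovForm_coAd (g : G) (ξ : E →L[𝕜] 𝕜) :
    kirillovForm I G (coAd I g ξ) =
      ((ContinuousLinearMap.compL 𝕜 E E 𝕜).flip (adModel I g⁻¹)).comp
        ((kirillovForm I G ξ).comp (adModel I g⁻¹)) := by
  have h1 := HasMFDerivAt.comp_of_apply_eq (E := E) (E' := E)
    (f := fun k : G => g⁻¹ * k * g⁻¹⁻¹)
    (hasMFDerivAt_coAd I G ξ) (by simp) (hasMFDerivAt_adModel I g⁻¹)
  have h2 := HasMFDerivAt.comp_of_apply_eq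
    (f := (fun k : G => coAd I k ξ) ∘ fun k : G => g⁻¹ * k * g⁻¹⁻¹)
    ((ContinuousLinearMap.compL 𝕜 E E 𝕜).flip (adModel I g⁻¹)).hasMFDerivAt rfl h1
  have h3 : ((ContinuousLinearMap.compL 𝕜 E E 𝕜).flip (adModel I g⁻¹)) ∘
      ((fun k : G => coAd I k ξ) ∘ fun k : G => g⁻¹ * k * g⁻¹⁻¹) =
      fun k : G => coAd I k (coAd I g ξ) := by
    ext1 k
    change (ξ.comp (adModel I (g⁻¹ * k * g⁻¹⁻¹)⁻¹)).comp (adModel I g⁻¹) =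
      (ξ.comp (adModel I g⁻¹)).comp (adModel I k⁻¹)
    rw [ContinuousLinearMap.comp_assoc, ContinuousLinearMap.comp_assoc, ← adModel_mul,
      ← adModel_mul]
    simp [mul_assoc]
  rw [h3] at h2
  have h4 : -kirillovForm I G (coAd I g ξ) =
      ((ContinuousLinearMap.compL 𝕜 E E 𝕜).flip (adModel I g⁻¹)).comp
        ((-kirillovForm I G ξ).comp (adModel I g⁻¹)) :=
    hasMFDerivAt_unique (hasMFDerivAt_coAd I G (coAd I g ξ)) h2
  ext x y
  have h5 := DFunLike.congr_fun (DFunLike.congr_fun h4 x) y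
  simp only [ContinuousLinearMap.comp_apply, neg_apply, map_neg] at h5 ⊢
  exact neg_injective h5

variable {G} in
theorem finrank_range_kirillovForm_coAd (g : G) (ξ : E →L[𝕜] 𝕜) :
    Module.finrank 𝕜 (LinearMap.range (kirillovForm I G (coAd I g ξ)).toLinearMap) =
      Module.finrank 𝕜 (LinearMap.range (kirillovForm I G ξ).toLinearMap) := by
  have hinj : Function.Injective
      ((ContinuousLinearMap.compL 𝕜 E E 𝕜).flip (adModel I g⁻¹)).toLinearMap := by
    intro η η' h
    ext x
    obtain ⟨y, rfl⟩ := adModel_surjective I g⁻¹ x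
    exact DFunLike.congr_fun h y
  rw [kirillovForm_coAd, ContinuousLinearMap.toLinearMap_comp, ContinuousLinearMap.toLinearMap_comp,
    LinearMap.range_comp, LinearMap.range_comp_of_range_eq_top _
      (LinearMap.range_eq_top.2 (adModel_surjective I g⁻¹))]
  exact (Submodule.equivMapOfInjective _ hinj _).finrank_eq.symm

/-- The rank is constant along the orbit, so the condition at all its points reduces to the one at
ξ. -/
theorem mem_orbitDimEq_iff (d : ℕ) (ξ : E →L[𝕜] 𝕜) :
    ξ ∈ orbitDimEq I G d ↔
      Module.finrank 𝕜 (LinearMap.range (kirillovForm I G ξ).toLinearMap) = d := by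
  constructor
  · intro h
    have h1 := h ξ ⟨1, by
      change coAd I 1 ξ = ξ
      rw [coAd_eq, inv_one, adModel_one, ContinuousLinearMap.comp_id]⟩
    rwa [orbitTangentSpace_eq] at h1
  · rintro h _ ⟨g, rfl⟩
    rw [orbitTangentSpace_eq]
    exact (finrank_range_kirillovForm_coAd I g ξ).trans h

theorem even_finrank_range_kirillovForm [FiniteDimensional 𝕜 E] (ξ : E →L[𝕜] 𝕜) :
    Even (Module.finrank 𝕜 (LinearMap.range (kirillovForm I G ξ).toLinearMap)) := by
  let B : LinearMap.BilinForm 𝕜 E :=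
    (ContinuousLinearMap.coeLM 𝕜 : (E →L[𝕜] 𝕜) →ₗ[𝕜] E →ₗ[𝕜] 𝕜) ∘ₗ
      (kirillovForm I G ξ).toLinearMap
  have hB : B.IsAlt := fun x => by
    have h0 : bracketModel I G x x = 0 :=
      (bracketModel_apply I G x x).trans (lie_self (L := GroupLieAlgebra I G) x)
    exact (congrArg ξ h0).trans (map_zero ξ)
  have h := LinearMap.IsAlt.even_finrank_range hB
  -- Forgetting continuity of functionals is injective, so the rank is unchanged.
  rw [LinearMap.range_comp] at h
  rwa [← (Submodule.equivMapOfInjective _ ContinuousLinearMap.coe_injective _).finrank_eq] at h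

end Coadjoint

/-! ### Closed fibres and the conclusion -/

/-- Each fibre is the complement of the finite union of the other fibres. -/
theorem isLocallyConstant_of_isClosed_fiber {X : Type*} [TopologicalSpace X] {r : X → ℕ} {m : ℕ}
    (hm : ∀ x, r x ≤ m) (h : ∀ d ≤ m, IsClosed (r ⁻¹' {d})) : IsLocallyConstant r := by
  rw [IsLocallyConstant.iff_isOpen_fiber]
  intro d
  have h1 : r ⁻¹' {d} = (⋃ j ∈ (Finset.range (m + 1)).erase d, r ⁻¹' {j})ᶜ := by
    ext x
    have := hm x
    simp only [Set.mem_preimage, Set.mem_singleton_iff, Set.mem_compl_iff, Set.mem_iUnion,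
      Finset.mem_erase, Finset.mem_range, not_exists]
    exact ⟨fun h j hj h' => hj.1 (h'.symm.trans h),
      fun h => by_contra fun hne => h _ ⟨hne, Nat.lt_succ_of_le this⟩ rfl⟩
  rw [h1, isOpen_compl_iff]
  refine isClosed_biUnion_finset fun j hj => h j ?_
  exact Nat.lt_succ_iff.1 (Finset.mem_range.1 (Finset.mem_of_mem_erase hj))

theorem proposition6p1 {𝕜 : Type*} [RCLike 𝕜]
    {E : Type*} [NormedAddCommGroup E] [NormedSpace 𝕜 E] [FiniteDimensional 𝕜 E]
    {H : Type*} [TopologicalSpace H] (I : ModelWithCorners 𝕜 E H) [I.Boundaryless]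
    (G : Type*) [TopologicalSpace G] [ChartedSpace H G] [Group G]
    [LieGroup I (minSmoothness 𝕜 3) G]
    (m : ℕ) (hm : 1 ≤ m) (hdim : Module.finrank 𝕜 E = m)
    (Ξ : Set (Coadjoint.LieDual I G)) :
    Continuous (fun ξ : Ξ => Coadjoint.stabilizer I G (ξ : Coadjoint.LieDual I G)) ↔
      ∀ d : ℕ, d ≤ m → Even d →
        IsClosed ((fun ξ : Ξ => (ξ : Coadjoint.LieDual I G)) ⁻¹' Coadjoint.orbitDimEq I G d) := by
  have : CompleteSpace E := FiniteDimensional.complete 𝕜 E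
  let K : Ξ → E →L[𝕜] E →L[𝕜] 𝕜 := fun ξ => Coadjoint.kirillovForm I G ξ
  have hK : Continuous K := (Coadjoint.continuous_kirillovForm I G).comp continuous_subtype_val
  let S : Ξ → Gr 𝕜 E := fun ξ => Coadjoint.stabilizer I G (ξ : Coadjoint.LieDual I G)
  have hS : ∀ ξ, S ξ = LinearMap.ker (K ξ).toLinearMap := fun ξ =>
    Coadjoint.stabilizer_eq_ker I G ξ.1
  let r : Ξ → ℕ := fun ξ => Module.finrank 𝕜 (LinearMap.range (K ξ).toLinearMap)
  have hrank : ∀ ξ, r ξ + (S ξ).finrank = m := fun ξ => by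
    rw [hS, ← hdim]
    exact LinearMap.finrank_range_add_finrank_ker (K ξ).toLinearMap
  have hfiber : ∀ d : ℕ, (fun ξ : Ξ => (ξ : Coadjoint.LieDual I G)) ⁻¹'
      Coadjoint.orbitDimEq I G d = r ⁻¹' {d} := fun d => by
    ext ξ
    exact Coadjoint.mem_orbitDimEq_iff I G d ξ.1
  simp only [hfiber]
  refine (Gr.continuous_iff_isLocallyConstant_finrank K hK S hS).trans ⟨fun h d _ _ => ?_,
    fun h => ?_⟩
  · have hr : r = (fun k => m - k) ∘ fun ξ => (S ξ).finrank := by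
      ext ξ
      have := hrank ξ
      simp only [Function.comp_apply]
      omega
    rw [hr]
    exact (h.comp _).isClosed_fiber d
  · have hr : IsLocallyConstant r := by
      refine isLocallyConstant_of_isClosed_fiber (m := m)
        (fun ξ => le_of_add_le_left (hrank ξ).le) fun d hd => ?_
      by_cases hev : Even d
      · exact h d hd hev
      · convert! isClosed_empty
        refine Set.eq_empty_of_forall_notMem fun ξ hξ => hev ?_
        rw [← show r ξ = d from hξ]
        exact Coadjoint.even_finrank_range_kirillovForm I G ξ.1
    have hSr : (fun ξ => (S ξ).finrank) = (fun k => m - k) ∘ r := by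
      ext ξ
      have := hrank ξ
      simp only [Function.comp_apply]
      omega
    rw [hSr]
    exact hr.comp _
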